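/- Let $S^1=\mathbb R/\mathbb Z$, let $\alpha\in\mathbb R$, and let $A\colon S^1\to \mathrm{SL}_2(\mathbb R)$, $\theta\mapsto A_\theta$, be continuous. Write $A^n_\theta$ ($n\in\mathbb Z$) for the $n$-step map of the discrete-time cocycle generated by $A$ over the rotation $\theta\mapsto\theta+\alpha$, i.e. $A^0_\theta=\mathrm{Id}$ and, for $n\ge 1$, $A^n_\theta=A_{\theta+(n-1)\alpha}\cdots A_{\theta+\alpha}A_\theta$ and $A^{-n}_\theta=A_{\theta-n\alpha}^{-1}\cdots A_{\theta-2\alpha}^{-1}A_{\theta-\alpha}^{-1}$. Let $\Theta_1=(S^1\times[0,1])/{\sim}$, with the quotient topology, be the mapping torus of the rotation by $\frac{\alpha}{2}$, where $\sim$ is the equivalence relation generated by $(\theta,1)\sim(\theta+\frac{\alpha}{2},0)$, and let $\phi^t(\theta,r)=\bigl(\theta+\lfloor r+t\rfloor\frac{\alpha}{2},\ r+t \bmod 1\bigr)$, $t\in\mathbb R$, be the suspension flow by $\frac{\alpha}{2}$ on $\Theta_1$. Then there is a continuous-time cocycle $\Phi$ in $\mathrm{SL}_3(\mathbb R)$ over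 $\phi^t$, that is, a family $\Phi^t_x\in \mathrm{SL}_3(\mathbb R)$ ($x\in\Theta_1$, $t\in\mathbb R$) which for some continuous map $G\colon\Theta_1\to\mathfrak{sl}_3(\mathbb R)$ (real $3\times 3$ matrices of trace $0$) satisfies $$\Phi^0_x=\mathrm{Id},\qquad \partial_t\Phi^t_x=G(\phi^t(x))\,\Phi^t_x\qquad\text{for all } x\in\Theta_1,\ t\in\mathbb R,$$ such that, writing elements of $\mathbb R^3$ as $(v,w)$ with $v\in\mathbb R^2$ and $w\in\mathbb R$, $$\Phi^n_{(\theta,0)}(v,w)=(A^n_{2\theta}v,\,w)\qquad\text{for all } n\in\mathbb Z,\ \theta\in S^1,\ v\in\mathbb R^2,\ w\in\mathbb R.$$ -/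

import Mathlib

open scoped MatrixGroups

noncomputable section

section Base

variable {Θ : Type*} [TopologicalSpace Θ]

/-- The forward part of the `n`-step map:
`A (φ^(n-1) θ) * ⋯ * A (φ θ) * A θ`, with the empty product `1` for `n = 0`. -/
def forwardStep {d : ℕ} (φ : Θ ≃ₜ Θ) (A : C(Θ, SL(d, ℝ))) : ℕ → Θ → SL(d, ℝ)
  | 0, _ => 1
  | n + 1, θ => A ((φ ^ n) θ) * forwardStep φ A n θ

/-- The backward part of the `n`-step map:
`(A (φ^(-n) θ))⁻¹ * ⋯ * (A (φ^(-2) θ))⁻¹ * (A (φ^(-1) θ))⁻¹`. -/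
def backwardStep {d : ℕ} (φ : Θ ≃ₜ Θ) (A : C(Θ, SL(d, ℝ))) : ℕ → Θ → SL(d, ℝ)
  | 0, _ => 1
  | n + 1, θ => (A ((φ ^ (-((n : ℤ) + 1))) θ))⁻¹ * backwardStep φ A n θ

/-- The `n`-step map `A^n_θ`, `n ∈ ℤ`, of the discrete-time cocycle over the homeomorphism `φ`
generated by the continuous map `A`. -/
def stepMap {d : ℕ} (φ : Θ ≃ₜ Θ) (A : C(Θ, SL(d, ℝ))) : ℤ → Θ → SL(d, ℝ)
  | Int.ofNat n, θ => forwardStep φ A n θ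
  | Int.negSucc n, θ => backwardStep φ A (n + 1) θ

/-- The gluing relation `(θ, 1) ~ (φ θ, 0)` on `Θ × [0, 1]`. -/
inductive MappingTorusRel (φ : Θ ≃ₜ Θ) : Θ × unitInterval → Θ × unitInterval → Prop
  | glue (θ : Θ) : MappingTorusRel φ (θ, 1) (φ θ, 0)

/-- The mapping torus of `φ`: the quotient of `Θ × [0, 1]` by the equivalence relation
generated by `(θ, 1) ~ (φ θ, 0)`. -/
def MappingTorus (φ : Θ ≃ₜ Θ) : Type _ := Quot (MappingTorusRel φ)

/-- The quotient topology on the mapping torus. -/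
instance MappingTorus.instTopologicalSpace (φ : Θ ≃ₜ Θ) : TopologicalSpace (MappingTorus φ) :=
  inferInstanceAs (TopologicalSpace (Quot (MappingTorusRel φ)))

/-- The point of the mapping torus represented by `(θ, r)`. -/
def MappingTorus.mk (φ : Θ ≃ₜ Θ) (θ : Θ) (r : unitInterval) : MappingTorus φ :=
  Quot.mk (MappingTorusRel φ) (θ, r)

/-- The suspension flow `φ^t (θ, r) = (φ^⌊r + t⌋ θ, r + t mod 1)` on the mapping torus. -/
def suspensionFlow (φ : Θ ≃ₜ Θ) (t : ℝ) : MappingTorus φ → MappingTorus φ :=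
  Quot.lift
    (fun p => MappingTorus.mk φ ((φ ^ ⌊(p.2 : ℝ) + t⌋) p.1)
      ⟨Int.fract ((p.2 : ℝ) + t), Int.fract_nonneg _, (Int.fract_lt_one _).le⟩)
    (by
      rintro _ _ ⟨θ⟩
      have h1 : ⌊(1 : ℝ) + t⌋ = ⌊t⌋ + 1 := by rw [add_comm, Int.floor_add_one]
      have h2 : Int.fract ((1 : ℝ) + t) = Int.fract t := by rw [add_comm, Int.fract_add_one]
      simp only [Set.Icc.coe_one, Set.Icc.coe_zero, zero_add, h1, h2, zpow_add_one]
      rfl)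

/-- `Φ` is a continuous-time cocycle in `SL(d, ℝ)` over the suspension flow of `φ`: there is a
continuous generator `G` on the mapping torus with values in the trace-free matrices such that
`Φ^0_x = Id` and `∂ₜ Φ^t_x = G (φ^t x) * Φ^t_x` (entry by entry) for all `x` and all `t ∈ ℝ`. -/
def IsContinuousTimeCocycle {d : ℕ} (φ : Θ ≃ₜ Θ)
    (Φ : ℝ → MappingTorus φ → SL(d, ℝ)) : Prop :=
  ∃ G : C(MappingTorus φ, LieAlgebra.SpecialLinear.sl (Fin d) ℝ),
    ∀ x : MappingTorus φ, Φ 0 x = 1 ∧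
      ∀ (t : ℝ) (i j : Fin d),
        HasDerivAt (fun s : ℝ => Φ s x i j)
          (((G (suspensionFlow φ t x) : Matrix (Fin d) (Fin d) ℝ) *
            (Φ t x : Matrix (Fin d) (Fin d) ℝ)) i j) t

end Base

/-- The circle rotation `θ ↦ θ + α` on `S¹ = ℝ / ℤ`. -/
def circleRotation (α : ℝ) : UnitAddCircle ≃ₜ UnitAddCircle :=
  Homeomorph.addRight (α : UnitAddCircle)

/-- The element `(v, w)` of `ℝ³` with `v ∈ ℝ²` and `w ∈ ℝ`. -/
def joinVec (v : Fin 2 → ℝ) (w : ℝ) : Fin 3 → ℝ := ![v 0, v 1, w]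

end

/-!
The cocycle over the rotation by `α` generated by `A` pulls back under `θ ↦ 2θ` to the cocycle over
the rotation by `α / 2` generated by `θ ↦ A (2θ)`. Continuous-time cocycles over the suspension
flow come from maps that are homotopic to the constant `1`: if `H t θ` is a homotopy from `1` to
`B θ` whose logarithmic time derivative is continuous and vanishes at both ends, then running `H`
during each turn of the suspension solves a linear equation with continuous generator, and its
time-one map is `B` (`SmoothNullhomotopy.cocycle`). So it suffices to find such a homotopy for
`B θ = diag (A (2θ), 1)`, i.e. to make explicit that twice a loop is trivial in
`π₁ (SL(3, ℝ)) = ℤ / 2`.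

The maps with such a homotopy form a monoid that is closed under conjugation by arbitrary continuous
maps and contains the transvections `1 + c(θ) E_{ij}` (`nullhomotopicMaps`). By the Iwasawa
decomposition (`exists_iwasawa`), `A (2θ)` is the product of a rotation, the square of a diagonal
matrix, and a transvection. Its rotation part is a loop run through twice, hence a square as well
(`exists_sq_eq_comp_two_nsmul`, by lifting to the universal cover). Finally, the plane reflection
that exchanges the coordinates is the restriction of a half turn `h` of `ℝ³`, and
conjugation by `h` inverts both rotations and diagonal matrices `g` of the plane. So `g²` is
`g h g⁻¹ h⁻¹`, the product of a conjugate of the constant `h` and the constant `h⁻¹ = h`, both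
of which are null-homotopic because `h` is a product of transvections (`cornerMap_sq_mem`).
-/

noncomputable section

/-! ### Smooth null-homotopies of matrix-valued maps -/

/-- A product rule for products of matrices, entry by entry. -/
theorem hasDerivAt_matrix_mul {m : Type*} [Fintype m] {M N : ℝ → Matrix m m ℝ}
    {M' N' : Matrix m m ℝ} {t : ℝ} (hM : ∀ i j, HasDerivAt (fun s => M s i j) (M' i j) t)
    (hN : ∀ i j, HasDerivAt (fun s => N s i j) (N' i j) t) (i j : m) :
    HasDerivAt (fun s => (M s * N s) i j) ((M' * N t + M t * N') i j) t := by
  simp only [Matrix.add_apply, Matrix.mul_apply, ← Finset.sum_add_distrib]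
  exact HasDerivAt.fun_sum fun k _ => (hM i k).mul (hN k j)

/-- Multiplication on the right by a constant matrix preserves a linear differential equation. -/
theorem hasDerivAt_matrix_mul_const {m : Type*} [Fintype m] {M : ℝ → Matrix m m ℝ}
    {K : Matrix m m ℝ} {t : ℝ} (hM : ∀ i j, HasDerivAt (fun s => M s i j) ((K * M t) i j) t)
    (C : Matrix m m ℝ) (i j : m) :
    HasDerivAt (fun s => (M s * C) i j) ((K * (M t * C)) i j) t := by
  simpa [Matrix.mul_assoc] using
    hasDerivAt_matrix_mul (N := fun _ => C) (N' := 0) hM (fun _ _ => hasDerivAt_const _ _) i j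

variable {Θ : Type*} [TopologicalSpace Θ] {d : ℕ}

/-- A null-homotopy `H` of `B : Θ → SL(d, ℝ)`, from the constant `1` to `B`, parametrized by
all of `ℝ` but constant in time outside `(0, 1)`, and differentiable in time with
`∂ₜ H = K * H` for a jointly continuous trace-free `K` that is supported in `[0, 1]`. -/
structure SmoothNullhomotopy (B : C(Θ, SL(d, ℝ))) where
  /-- The homotopy, from `1` to `B`. -/
  map : C(ℝ × Θ, SL(d, ℝ))
  /-- Its logarithmic time derivative. -/
  gen : C(ℝ × Θ, Matrix (Fin d) (Fin d) ℝ)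
  trace_gen : ∀ p, (gen p).trace = 0
  map_of_nonpos : ∀ t ≤ 0, ∀ θ, map (t, θ) = 1
  map_of_one_le : ∀ t ≥ 1, ∀ θ, map (t, θ) = B θ
  gen_of_nonpos : ∀ t ≤ 0, ∀ θ, gen (t, θ) = 0
  gen_of_one_le : ∀ t ≥ 1, ∀ θ, gen (t, θ) = 0
  hasDerivAt : ∀ t θ i j, HasDerivAt (fun s => (map (s, θ)).1 i j)
    ((gen (t, θ) * (map (t, θ)).1) i j) t

namespace SmoothNullhomotopy

/-- The constant null-homotopy of `1`. -/
def one : SmoothNullhomotopy (1 : C(Θ, SL(d, ℝ))) where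
  map := 1
  gen := 0
  trace_gen := by simp
  map_of_nonpos := by simp
  map_of_one_le := by simp
  gen_of_nonpos := by simp
  gen_of_one_le := by simp
  hasDerivAt t θ i j := by simpa using hasDerivAt_const t _

theorem inv_mul_cancel_coe (g : SL(d, ℝ)) : (g⁻¹).1 * g.1 = 1 :=
  congrArg Subtype.val (inv_mul_cancel g)

theorem trace_conj (g : SL(d, ℝ)) (K : Matrix (Fin d) (Fin d) ℝ) :
    (g.1 * K * (g⁻¹).1).trace = K.trace := by
  rw [Matrix.trace_mul_comm, ← Matrix.mul_assoc, inv_mul_cancel_coe, Matrix.one_mul]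

/-- The generator of a product of two solutions of linear equations. -/
theorem gen_mul (g h : SL(d, ℝ)) (K₁ K₂ : Matrix (Fin d) (Fin d) ℝ) :
    (K₁ + g.1 * K₂ * (g⁻¹).1) * (g.1 * h.1) = K₁ * g.1 * h.1 + g.1 * (K₂ * h.1) := by
  have : (g⁻¹).1 * (g.1 * h.1) = h.1 := by
    rw [← Matrix.mul_assoc, inv_mul_cancel_coe, Matrix.one_mul]
  rw [add_mul, Matrix.mul_assoc _ (g⁻¹).1, this, Matrix.mul_assoc, Matrix.mul_assoc]

/-- The pointwise product of two null-homotopies. -/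
def mul {B₁ B₂ : C(Θ, SL(d, ℝ))} (H₁ : SmoothNullhomotopy B₁) (H₂ : SmoothNullhomotopy B₂) :
    SmoothNullhomotopy (B₁ * B₂) where
  map := H₁.map * H₂.map
  gen := ⟨fun p => H₁.gen p + (H₁.map p).1 * H₂.gen p * (H₁.map p)⁻¹.1, by
    have h₁ : Continuous fun p => (H₁.map p).1 :=
      continuous_subtype_val.comp H₁.map.continuous
    have h₂ : Continuous fun p => (H₁.map p)⁻¹.1 :=
      continuous_subtype_val.comp H₁.map.continuous.inv
    fun_prop⟩
  trace_gen p := by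
    simp only [ContinuousMap.coe_mk]
    rw [Matrix.trace_add, trace_conj, H₁.trace_gen, H₂.trace_gen, add_zero]
  map_of_nonpos t ht θ := by simp [H₁.map_of_nonpos t ht, H₂.map_of_nonpos t ht]
  map_of_one_le t ht θ := by simp [H₁.map_of_one_le t ht, H₂.map_of_one_le t ht]
  gen_of_nonpos t ht θ := by simp [H₁.gen_of_nonpos t ht, H₂.gen_of_nonpos t ht]
  gen_of_one_le t ht θ := by simp [H₁.gen_of_one_le t ht, H₂.gen_of_one_le t ht]
  hasDerivAt t θ i j := by
    exact (hasDerivAt_matrix_mul (H₁.hasDerivAt t θ) (H₂.hasDerivAt t θ) i j).congr_deriv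
      (congrFun₂ (gen_mul (H₁.map (t, θ)) (H₂.map (t, θ)) _ _) i j).symm

/-- The conjugate of a null-homotopy by a (time-independent) continuous map. -/
def conj {B : C(Θ, SL(d, ℝ))} (H : SmoothNullhomotopy B) (g : C(Θ, SL(d, ℝ))) :
    SmoothNullhomotopy (g * B * g⁻¹) where
  map := ⟨fun p => g p.2 * H.map p * (g p.2)⁻¹, by fun_prop⟩
  gen := ⟨fun p => (g p.2).1 * H.gen p * (g p.2)⁻¹.1, by
    have h₁ : Continuous fun p : ℝ × Θ => (g p.2).1 :=
      continuous_subtype_val.comp (g.continuous.comp continuous_snd)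
    have h₂ : Continuous fun p : ℝ × Θ => (g p.2)⁻¹.1 :=
      continuous_subtype_val.comp (g.continuous.comp continuous_snd).inv
    fun_prop⟩
  trace_gen p := (trace_conj _ _).trans (H.trace_gen p)
  map_of_nonpos t ht θ := by simp [H.map_of_nonpos t ht]
  map_of_one_le t ht θ := by simp [H.map_of_one_le t ht]
  gen_of_nonpos t ht θ := by simp [H.gen_of_nonpos t ht]
  gen_of_one_le t ht θ := by simp [H.gen_of_one_le t ht]
  hasDerivAt t θ i j := by
    have hd := hasDerivAt_matrix_mul (M := fun _ => (g θ).1) (M' := 0)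
      (fun _ _ => hasDerivAt_const _ _)
      (hasDerivAt_matrix_mul_const (H.hasDerivAt t θ) (g θ)⁻¹.1) i j
    have hg := gen_mul (g θ) (H.map (t, θ) * (g θ)⁻¹) 0 (H.gen (t, θ))
    rw [zero_add, Matrix.zero_mul, Matrix.zero_mul] at hg
    rw [Matrix.zero_mul] at hd
    have hm (s : ℝ) : (g θ * H.map (s, θ) * (g θ)⁻¹).1 =
        (g θ).1 * ((H.map (s, θ)).1 * (g θ)⁻¹.1) := Matrix.mul_assoc _ _ _
    simp only [ContinuousMap.coe_mk, hm]
    exact hd.congr_deriv (congrFun₂ hg i j).symm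

theorem deriv_smoothTransition_of_nonpos {t : ℝ} (ht : t ≤ 0) :
    deriv Real.smoothTransition t = 0 :=
  IsLocalMin.deriv_eq_zero <| Filter.Eventually.of_forall fun s => by
    rw [Real.smoothTransition.zero_of_nonpos ht]; exact Real.smoothTransition.nonneg s

theorem deriv_smoothTransition_of_one_le {t : ℝ} (ht : 1 ≤ t) :
    deriv Real.smoothTransition t = 0 :=
  IsLocalMax.deriv_eq_zero <| Filter.Eventually.of_forall fun s => by
    rw [Real.smoothTransition.one_of_one_le ht]; exact Real.smoothTransition.le_one s

end SmoothNullhomotopy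

/-- The map `θ ↦ 1 + c(θ) E_{ij}` into `SL(d, ℝ)`. -/
def transvectionMap {i j : Fin d} (hij : i ≠ j) (c : C(Θ, ℝ)) : C(Θ, SL(d, ℝ)) :=
  ⟨fun θ => Matrix.SpecialLinearGroup.transvection hij (c θ), by
    refine Continuous.subtype_mk (continuous_matrix fun k l => ?_) _
    simp only [Matrix.transvection, Matrix.add_apply, Matrix.single_apply]
    split_ifs <;> fun_prop⟩

/-- The straight-line null-homotopy `1 + s(t) c(θ) E_{ij}` of a transvection, run with the smooth
speed `s = Real.smoothTransition`. -/
def SmoothNullhomotopy.transvection {i j : Fin d} (hij : i ≠ j) (c : C(Θ, ℝ)) :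
    SmoothNullhomotopy (transvectionMap hij c) where
  map := transvectionMap hij
    ⟨fun p => Real.smoothTransition p.1 * c p.2, by
      have := Real.smoothTransition.continuous
      fun_prop⟩
  gen := ⟨fun p => Matrix.single i j (deriv Real.smoothTransition p.1 * c p.2), by
    have h : Continuous (deriv Real.smoothTransition) :=
      (Real.smoothTransition.contDiff (n := 1)).continuous_deriv le_rfl
    refine continuous_matrix fun k l => ?_
    simp only [Matrix.single_apply]
    split_ifs <;> fun_prop⟩
  trace_gen p := Matrix.trace_single_eq_of_ne _ _ _ hij
  map_of_nonpos t ht θ := by simp [transvectionMap, Real.smoothTransition.zero_of_nonpos ht,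
    Matrix.SpecialLinearGroup.transvection_coeff_zero]
  map_of_one_le t ht θ := congrArg (Matrix.SpecialLinearGroup.transvection hij) <| by
    simp [Real.smoothTransition.one_of_one_le ht]
  gen_of_nonpos t ht θ := by simp [deriv_smoothTransition_of_nonpos ht]
  gen_of_one_le t ht θ := by simp [deriv_smoothTransition_of_one_le ht]
  hasDerivAt t θ k l := by
    have hs : HasDerivAt Real.smoothTransition (deriv Real.smoothTransition t) t :=
      ((Real.smoothTransition.contDiff (n := 1)).differentiable one_ne_zero t).hasDerivAt
    -- `E_{ij}` squares to zero, so the derivative of `1 + s(t) c E_{ij}` equals its generator.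
    have hK (a b : ℝ) : Matrix.single i j a * (Matrix.SpecialLinearGroup.transvection hij b).1 =
        Matrix.single i j a := by
      rw [Matrix.SpecialLinearGroup.transvection_coe, Matrix.mul_add, Matrix.mul_one,
        Matrix.single_mul_single_of_ne _ _ _ _ hij.symm, add_zero]
    refine HasDerivAt.congr_deriv ?_ (congrFun₂ (hK _ _) k l).symm
    change HasDerivAt (fun s => (1 : Matrix (Fin d) (Fin d) ℝ) k l +
      Matrix.single i j (Real.smoothTransition s * c θ) k l) _ t
    simp only [Matrix.single_apply]
    split_ifs
    · exact (hs.mul_const (c θ)).const_add _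
    · exact hasDerivAt_const t _

/-- The submonoid of the maps `Θ → SL(d, ℝ)` that admit a smooth null-homotopy. -/
def nullhomotopicMaps (Θ : Type*) [TopologicalSpace Θ] (d : ℕ) : Submonoid C(Θ, SL(d, ℝ)) where
  carrier := {B | Nonempty (SmoothNullhomotopy B)}
  one_mem' := ⟨.one⟩
  mul_mem' := fun ⟨H₁⟩ ⟨H₂⟩ => ⟨H₁.mul H₂⟩

theorem conj_mem_nullhomotopicMaps {B : C(Θ, SL(d, ℝ))} (hB : B ∈ nullhomotopicMaps Θ d)
    (g : C(Θ, SL(d, ℝ))) : g * B * g⁻¹ ∈ nullhomotopicMaps Θ d :=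
  hB.elim fun H => ⟨H.conj g⟩

theorem transvectionMap_mem_nullhomotopicMaps {i j : Fin d} (hij : i ≠ j) (c : C(Θ, ℝ)) :
    transvectionMap hij c ∈ nullhomotopicMaps Θ d :=
  ⟨.transvection hij c⟩

/-! ### The step maps of a discrete-time cocycle -/

theorem stepMap_zero (φ : Θ ≃ₜ Θ) (A : C(Θ, SL(d, ℝ))) (θ : Θ) : stepMap φ A 0 θ = 1 := rfl

theorem stepMap_neg_natCast (φ : Θ ≃ₜ Θ) (A : C(Θ, SL(d, ℝ))) (n : ℕ) (θ : Θ) :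
    stepMap φ A (-(n : ℤ)) θ = backwardStep φ A n θ := by
  cases n <;> rfl

theorem stepMap_add_one (φ : Θ ≃ₜ Θ) (A : C(Θ, SL(d, ℝ))) (n : ℤ) (θ : Θ) :
    stepMap φ A (n + 1) θ = A ((φ ^ n) θ) * stepMap φ A n θ := by
  cases n with
  | ofNat n => rfl
  | negSucc n =>
    have h : Int.negSucc n + 1 = -(n : ℤ) := by omega
    have h' : Int.negSucc n = -((n : ℤ) + 1) := by omega
    rw [h, stepMap_neg_natCast]
    change _ = _ * ((A ((φ ^ (-((n : ℤ) + 1))) θ))⁻¹ * backwardStep φ A n θ)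
    rw [h', mul_inv_cancel_left]

theorem stepMap_add_one' (φ : Θ ≃ₜ Θ) (A : C(Θ, SL(d, ℝ))) (n : ℤ) (θ : Θ) :
    stepMap φ A (n + 1) θ = stepMap φ A n (φ θ) * A θ := by
  have key (m : ℤ) : stepMap φ A (m + 1 + 1) θ = stepMap φ A (m + 1) (φ θ) * A θ ↔
      stepMap φ A (m + 1) θ = stepMap φ A m (φ θ) * A θ := by
    have h : (φ ^ (m + 1)) θ = (φ ^ m) (φ θ) := by rw [zpow_add_one]; rfl
    rw [stepMap_add_one φ A (m + 1), stepMap_add_one φ A m (φ θ), h, mul_assoc,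
      mul_right_inj]
  induction n using Int.induction_on with
  | zero => rw [stepMap_add_one, stepMap_zero, stepMap_zero, mul_one, one_mul]; rfl
  | succ n ih => exact (key n).2 ih
  | pred n ih =>
    refine (key _).1 ?_
    simpa using ih

/-! ### Suspending a null-homotopic cocycle -/

namespace SmoothNullhomotopy

variable {φ : Θ ≃ₜ Θ} {B : C(Θ, SL(d, ℝ))} (H : SmoothNullhomotopy B)

/-- The solution at time `τ`, started from `1` at the point `(θ, 0)` of the mapping torus of `φ`:
after `⌊τ⌋` complete turns, the null-homotopy is run for the remaining time `fract τ`. -/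
def solution (φ : Θ ≃ₜ Θ) (τ : ℝ) (θ : Θ) : SL(d, ℝ) :=
  H.map (Int.fract τ, (φ ^ ⌊τ⌋) θ) * stepMap φ B ⌊τ⌋ θ

theorem solution_intCast (n : ℤ) (θ : Θ) : H.solution φ n θ = stepMap φ B n θ := by
  simp [solution, H.map_of_nonpos 0 le_rfl]

theorem solution_zero (θ : Θ) : H.solution φ 0 θ = 1 := by
  simpa [stepMap_zero] using H.solution_intCast (φ := φ) 0 θ

theorem solution_one_add (τ : ℝ) (θ : Θ) :
    H.solution φ (1 + τ) θ = H.solution φ τ (φ θ) * B θ := by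
  have h1 : ⌊1 + τ⌋ = ⌊τ⌋ + 1 := by rw [add_comm, Int.floor_add_one]
  have h2 : Int.fract (1 + τ) = Int.fract τ := by rw [add_comm, Int.fract_add_one]
  simp only [solution, h1, h2, stepMap_add_one', zpow_add_one, mul_assoc]
  rfl

/-- Near an integer `n` the solution has a formula that does not refer to integer parts. -/
theorem solution_eq {n : ℤ} {τ : ℝ} (h₁ : (n : ℝ) - 1 < τ) (h₂ : τ < n + 1) (θ : Θ) :
    H.solution φ τ θ = H.map (τ - n, (φ ^ n) θ) *
      (H.map (τ - (n - 1), (φ ^ (n - 1)) θ) * stepMap φ B (n - 1) θ) := by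
  rcases lt_or_ge τ n with h | h
  · have hf : ⌊τ⌋ = n - 1 := Int.floor_eq_iff.2 ⟨by push_cast; linarith, by push_cast; linarith⟩
    rw [H.map_of_nonpos (τ - n) (by linarith), one_mul, solution, Int.fract, hf]
    push_cast
    rfl
  · have hf : ⌊τ⌋ = n := Int.floor_eq_iff.2 ⟨h, h₂⟩
    rw [H.map_of_one_le (τ - (n - 1)) (by linarith), ← stepMap_add_one, sub_add_cancel, solution,
      Int.fract, hf]

theorem hasDerivAt_solution (τ : ℝ) (θ : Θ) (i j : Fin d) :
    HasDerivAt (fun s => (H.solution φ s θ).1 i j)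
      ((H.gen (Int.fract τ, (φ ^ ⌊τ⌋) θ) * (H.solution φ τ θ).1) i j) τ := by
  have h₁ : ((⌊τ⌋ : ℤ) : ℝ) - 1 < τ := by linarith [Int.floor_le τ]
  have h₂ : τ < ⌊τ⌋ + 1 := Int.lt_floor_add_one τ
  set n := ⌊τ⌋ with hn
  have hev : (fun s => (H.solution φ s θ).1 i j) =ᶠ[nhds τ] fun s =>
      ((H.map (s - n, (φ ^ n) θ)).1 * ((H.map (s - (n - 1), (φ ^ (n - 1)) θ)).1 *
        (stepMap φ B (n - 1) θ).1)) i j := by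
    filter_upwards [Ioo_mem_nhds h₁ h₂] with s hs
    rw [H.solution_eq hs.1 hs.2]
    rfl
  refine HasDerivAt.congr_of_eventuallyEq ?_ hev
  have hM (k l : Fin d) := (H.hasDerivAt (τ - n) ((φ ^ n) θ) k l).comp_sub_const τ (n : ℝ)
  have hN (k l : Fin d) :=
    (H.hasDerivAt (τ - (n - 1)) ((φ ^ (n - 1)) θ) k l).comp_sub_const τ ((n : ℝ) - 1)
  -- At and after the integer time `n`, the null-homotopy of the preceding turn is stationary.
  rw [H.gen_of_one_le (τ - (n - 1)) (by linarith [Int.floor_le τ])] at hN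
  have hN' := hasDerivAt_matrix_mul_const hN (stepMap φ B (n - 1) θ).1
  simp only [Matrix.zero_mul] at hN'
  refine (hasDerivAt_matrix_mul hM hN' i j).congr_deriv ?_
  rw [H.solution_eq h₁ h₂, Matrix.mul_zero, add_zero, Int.fract, ← hn, Matrix.mul_assoc]
  rfl

/-- The generator on the mapping torus; it respects the gluing since the generator of a smooth
null-homotopy vanishes at the times `0` and `1`. -/
def torusGen (φ : Θ ≃ₜ Θ) : C(MappingTorus φ, LieAlgebra.SpecialLinear.sl (Fin d) ℝ) where
  toFun := Quot.lift (fun p => ⟨H.gen (p.2, p.1), H.trace_gen _⟩) (by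
    rintro _ _ ⟨θ⟩
    simp [H.gen_of_nonpos 0 le_rfl, H.gen_of_one_le 1 le_rfl])
  continuous_toFun := by
    refine continuous_quot_lift _ (Continuous.subtype_mk ?_ _)
    fun_prop

/-- The continuous-time cocycle over the suspension flow: the solution started from `(θ, 0)`,
normalized to be `1` at the point `(θ, r)`. -/
def cocycle (φ : Θ ≃ₜ Θ) (t : ℝ) : MappingTorus φ → SL(d, ℝ) :=
  Quot.lift (fun p => H.solution φ (p.2 + t) p.1 * (H.solution φ p.2 p.1)⁻¹) (by
    rintro _ _ ⟨θ⟩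
    have h := H.solution_one_add (φ := φ) 0 θ
    rw [add_zero, solution_zero, one_mul] at h
    simp [solution_one_add, solution_zero, h])

theorem isContinuousTimeCocycle (φ : Θ ≃ₜ Θ) : IsContinuousTimeCocycle φ (H.cocycle φ) := by
  refine ⟨H.torusGen φ, fun x => ?_⟩
  obtain ⟨θ, r⟩ := x
  refine ⟨?_, fun t i j => ?_⟩
  · change H.solution φ (r + 0) θ * (H.solution φ r θ)⁻¹ = 1
    rw [add_zero, mul_inv_cancel]
  · exact hasDerivAt_matrix_mul_const (M := fun s => (H.solution φ (r + s) θ).1)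
      (fun k l => (H.hasDerivAt_solution (φ := φ) (r + t) θ k l).comp_const_add (r : ℝ) t)
      (H.solution φ r θ)⁻¹.1 i j

theorem cocycle_intCast (φ : Θ ≃ₜ Θ) (n : ℤ) (θ : Θ) :
    H.cocycle φ n (MappingTorus.mk φ θ 0) = stepMap φ B n θ := by
  change H.solution φ (((0 : unitInterval) : ℝ) + n) θ *
    (H.solution φ ((0 : unitInterval) : ℝ) θ)⁻¹ = _
  rw [Set.Icc.coe_zero, zero_add, solution_zero, inv_one, mul_one, solution_intCast]

end SmoothNullhomotopy

/-! ### Squares of loops in `SL(2, ℝ)` inside `SL(3, ℝ)` -/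

/-- The embedding `g ↦ diag(g, 1)` of `SL(2, ℝ)` into `SL(3, ℝ)`. -/
def corner : SL(2, ℝ) →* SL(3, ℝ) where
  toFun g := ⟨!![g 0 0, g 0 1, 0; g 1 0, g 1 1, 0; 0, 0, 1], by
    have h := g.2
    rw [Matrix.det_fin_two] at h
    simpa [Matrix.det_fin_three] using h⟩
  map_one' := by
    ext i j
    fin_cases i <;> fin_cases j <;> simp
  map_mul' g h := by
    refine Subtype.ext ?_
    change _ = !![g 0 0, g 0 1, 0; g 1 0, g 1 1, 0; 0, 0, 1] *
      !![h 0 0, h 0 1, 0; h 1 0, h 1 1, 0; 0, 0, 1]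
    ext i j
    fin_cases i <;> fin_cases j <;>
      simp [Matrix.mul_apply, Fin.sum_univ_three, Fin.sum_univ_two]

theorem corner_coe (g : SL(2, ℝ)) :
    (corner g).1 = !![g 0 0, g 0 1, 0; g 1 0, g 1 1, 0; 0, 0, 1] := rfl

theorem continuous_corner : Continuous corner := by
  refine Continuous.subtype_mk (continuous_matrix fun i j => ?_) _
  have h (i j : Fin 2) : Continuous fun g : SL(2, ℝ) => g i j :=
    (continuous_apply j).comp ((continuous_apply i).comp continuous_subtype_val)
  fin_cases i <;> fin_cases j <;> first | exact h _ _ | exact continuous_const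

theorem corner_mulVec (g : SL(2, ℝ)) (v : Fin 2 → ℝ) (w : ℝ) :
    (corner g).1.mulVec (joinVec v w) = joinVec (g.1.mulVec v) w := by
  ext i
  rw [corner_coe]
  fin_cases i <;> simp [joinVec, Matrix.mulVec, dotProduct, Fin.sum_univ_three, Fin.sum_univ_two]

variable (Θ) in
/-- The embedding `corner`, applied pointwise. -/
def cornerMap : C(Θ, SL(2, ℝ)) →* C(Θ, SL(3, ℝ)) :=
  corner.compLeftContinuous Θ continuous_corner

theorem cornerMap_transvectionMap (c : C(Θ, ℝ)) :
    cornerMap Θ (transvectionMap (zero_ne_one' (Fin 2)) c) =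
      transvectionMap (zero_ne_one' (Fin 3)) c := by
  refine ContinuousMap.ext fun θ => Subtype.ext ?_
  ext i j
  change (corner (.transvection (zero_ne_one' (Fin 2)) (c θ))).1 i j =
    (Matrix.SpecialLinearGroup.transvection (zero_ne_one' (Fin 3)) (c θ)).1 i j
  rw [corner_coe]
  fin_cases i <;> fin_cases j <;> simp [Matrix.SpecialLinearGroup.transvection_coe]

/-- The quarter turn in the plane of the coordinates `i` and `j`, as a product of
transvections. -/
def quarterTurn {i j : Fin d} (hij : i ≠ j) : SL(d, ℝ) :=
  .transvection hij (-1) * .transvection hij.symm 1 * .transvection hij (-1)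

theorem const_quarterTurn_mem {i j : Fin d} (hij : i ≠ j) :
    ContinuousMap.const Θ (quarterTurn hij) ∈ nullhomotopicMaps Θ d :=
  mul_mem (mul_mem (transvectionMap_mem_nullhomotopicMaps hij (.const Θ (-1)))
    (transvectionMap_mem_nullhomotopicMaps hij.symm (.const Θ 1)))
    (transvectionMap_mem_nullhomotopicMaps hij (.const Θ (-1)))

/-- The half turn about the axis spanned by `e₀ + e₁`, which exchanges `e₀` and `e₁` and
reverses `e₂`. It restricts to a reflection of the plane of `e₀` and `e₁`. -/
def swapTurn : SL(3, ℝ) :=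
  quarterTurn (i := 0) (j := 1) (by decide) *
    (quarterTurn (i := 1) (j := 2) (by decide) * quarterTurn (i := 1) (j := 2) (by decide))

theorem swapTurn_coe : swapTurn.1 = !![0, 1, 0; 1, 0, 0; 0, 0, -1] := by
  have h₁ : (quarterTurn (i := (0 : Fin 3)) (j := 1) (by decide)).1 =
      !![0, -1, 0; 1, 0, 0; 0, 0, 1] := by
    ext i j
    fin_cases i <;> fin_cases j <;>
      simp [quarterTurn, Matrix.SpecialLinearGroup.transvection_coe, Matrix.mul_apply,
        Fin.sum_univ_three]
  have h₂ : (quarterTurn (i := (1 : Fin 3)) (j := 2) (by decide)).1 =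
      !![1, 0, 0; 0, 0, -1; 0, 1, 0] := by
    ext i j
    fin_cases i <;> fin_cases j <;>
      simp [quarterTurn, Matrix.SpecialLinearGroup.transvection_coe, Matrix.mul_apply,
        Fin.sum_univ_three]
  rw [swapTurn, Matrix.SpecialLinearGroup.coe_mul, Matrix.SpecialLinearGroup.coe_mul, h₁, h₂]
  ext i j
  fin_cases i <;> fin_cases j <;> simp [Matrix.mul_apply, Fin.sum_univ_three]

theorem const_swapTurn_mem : ContinuousMap.const Θ swapTurn ∈ nullhomotopicMaps Θ 3 :=
  mul_mem (const_quarterTurn_mem _) (mul_mem (const_quarterTurn_mem _) (const_quarterTurn_mem _))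

/-- Conjugation by the reflection `swapTurn` inverts both rotations and diagonal matrices. -/
theorem swapTurn_conj (g : SL(2, ℝ)) (hg : g 0 1 = -g 1 0) :
    swapTurn * (corner g)⁻¹ * swapTurn = corner g := by
  rw [← map_inv]
  ext i j
  rw [Matrix.SpecialLinearGroup.coe_mul, Matrix.SpecialLinearGroup.coe_mul, swapTurn_coe,
    corner_coe, corner_coe, Matrix.SpecialLinearGroup.SL2_inv_expl]
  fin_cases i <;> fin_cases j <;> simp [Matrix.mul_apply, Fin.sum_univ_three, hg]

/-- If `g` is inverted by conjugation with the constant involution `h = swapTurn`, then its square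
is the commutator `g h g⁻¹ h⁻¹`, a product of two null-homotopic maps: a conjugate of a constant,
and a constant. -/
theorem cornerMap_sq_mem {g : C(Θ, SL(2, ℝ))} (hg : ∀ θ, g θ 0 1 = -g θ 1 0) :
    cornerMap Θ (g ^ 2) ∈ nullhomotopicMaps Θ 3 := by
  have h : cornerMap Θ (g ^ 2) = cornerMap Θ g * ContinuousMap.const Θ swapTurn *
      (cornerMap Θ g)⁻¹ * ContinuousMap.const Θ swapTurn := by
    rw [map_pow, sq, mul_assoc, mul_assoc]
    congr 1
    refine ContinuousMap.ext fun θ => ?_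
    exact (swapTurn_conj (g θ) (hg θ)).symm.trans (mul_assoc _ _ _)
  rw [h]
  exact mul_mem (conj_mem_nullhomotopicMaps const_swapTurn_mem _) const_swapTurn_mem

/-! ### Factorization of loops in `SL(2, ℝ)` -/

/-- The rotation of the plane by a point of the unit circle. -/
def planeRotation : Circle →* SL(2, ℝ) where
  toFun z := ⟨!![(z : ℂ).re, -(z : ℂ).im; (z : ℂ).im, (z : ℂ).re], by
    have h := Circle.normSq_coe z
    rw [Complex.normSq_apply] at h
    simpa [Matrix.det_fin_two] using h⟩
  map_one' := by
    ext i j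
    fin_cases i <;> fin_cases j <;> simp
  map_mul' z w := by
    refine Subtype.ext ?_
    change _ = !![(z : ℂ).re, -(z : ℂ).im; (z : ℂ).im, (z : ℂ).re] *
      !![(w : ℂ).re, -(w : ℂ).im; (w : ℂ).im, (w : ℂ).re]
    ext i j
    fin_cases i <;> fin_cases j <;> simp [Matrix.mul_apply, Fin.sum_univ_two] <;> ring

theorem planeRotation_coe (z : Circle) :
    (planeRotation z).1 = !![(z : ℂ).re, -(z : ℂ).im; (z : ℂ).im, (z : ℂ).re] := rfl

theorem continuous_planeRotation : Continuous planeRotation := by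
  refine Continuous.subtype_mk (continuous_matrix fun i j => ?_) _
  fin_cases i <;> fin_cases j
  · exact Complex.continuous_re.comp continuous_subtype_val
  · exact (Complex.continuous_im.comp continuous_subtype_val).neg
  · exact Complex.continuous_im.comp continuous_subtype_val
  · exact Complex.continuous_re.comp continuous_subtype_val

variable (Θ) in
/-- The homomorphism `planeRotation`, applied pointwise. -/
def rotationMap : C(Θ, Circle) →* C(Θ, SL(2, ℝ)) :=
  planeRotation.compLeftContinuous Θ continuous_planeRotation

/-- The map `θ ↦ diag(s(θ), s(θ)⁻¹)`. -/
def stretchMap (s : C(Θ, ℝ)) (hs : ∀ θ, s θ ≠ 0) : C(Θ, SL(2, ℝ)) where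
  toFun θ := ⟨!![s θ, 0; 0, (s θ)⁻¹], by simp [Matrix.det_fin_two, hs θ]⟩
  continuous_toFun := by
    refine Continuous.subtype_mk (continuous_matrix fun i j => ?_) _
    fin_cases i <;> fin_cases j
    · exact s.continuous
    · exact continuous_const
    · exact continuous_const
    · exact s.continuous.inv₀ hs

/-- The Iwasawa decomposition, depending continuously on the parameter. The diagonal factor is
positive and is written as a square. -/
theorem exists_iwasawa (A : C(Θ, SL(2, ℝ))) :
    ∃ (u : C(Θ, Circle)) (s : C(Θ, ℝ)) (hs : ∀ θ, s θ ≠ 0) (x : C(Θ, ℝ)),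
      A = rotationMap Θ u * stretchMap s hs ^ 2 *
        transvectionMap (zero_ne_one' (Fin 2)) x := by
  have hA (i j : Fin 2) : Continuous fun θ => A θ i j :=
    (continuous_apply j).comp
      (Matrix.SpecialLinearGroup.continuous_apply (fun θ => A θ) A.continuous i)
  have hdet (θ : Θ) : A θ 0 0 * A θ 1 1 - A θ 0 1 * A θ 1 0 = 1 := by
    rw [← Matrix.det_fin_two]; exact (A θ).2
  -- The first column of `A`, as a complex number.
  let z : Θ → ℂ := fun θ => ⟨A θ 0 0, A θ 1 0⟩
  have hz (θ : Θ) : z θ ≠ 0 := fun h => by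
    have h0 : A θ 0 0 = 0 := congrArg Complex.re h
    have h1 : A θ 1 0 = 0 := congrArg Complex.im h
    simpa [h0, h1] using hdet θ
  have hzc : Continuous z := by
    have : z = fun θ => Complex.equivRealProdCLM.symm (A θ 0 0, A θ 1 0) := rfl
    rw [this]
    exact Complex.equivRealProdCLM.symm.continuous.comp ((hA 0 0).prodMk (hA 1 0))
  have hn (θ : Θ) : 0 < ‖z θ‖ := norm_pos_iff.2 (hz θ)
  have hsq (θ : Θ) : ‖z θ‖ * ‖z θ‖ = A θ 0 0 * A θ 0 0 + A θ 1 0 * A θ 1 0 := by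
    rw [Complex.norm_mul_self_eq_normSq, Complex.normSq_apply]
  let u : C(Θ, Circle) := ⟨fun θ => ⟨z θ / ‖z θ‖, mem_sphere_zero_iff_norm.2 <| by
      simp [(hn θ).ne']⟩, by
    refine Continuous.subtype_mk (hzc.div (Complex.continuous_ofReal.comp hzc.norm) fun θ => ?_) _
    exact Complex.ofReal_ne_zero.2 (hn θ).ne'⟩
  let s : C(Θ, ℝ) := ⟨fun θ => √‖z θ‖, hzc.norm.sqrt⟩
  have hs (θ : Θ) : s θ ≠ 0 := (Real.sqrt_pos.2 (hn θ)).ne'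
  let x : C(Θ, ℝ) := ⟨fun θ => (A θ 0 0 * A θ 0 1 + A θ 1 0 * A θ 1 1) / (‖z θ‖ * ‖z θ‖),
    (((hA 0 0).mul (hA 0 1)).add ((hA 1 0).mul (hA 1 1))).div₀ (hzc.norm.mul hzc.norm)
      fun θ => (mul_pos (hn θ) (hn θ)).ne'⟩
  refine ⟨u, s, hs, x, ?_⟩
  refine ContinuousMap.ext fun θ => Subtype.ext ?_
  have hss : √‖z θ‖ * √‖z θ‖ = ‖z θ‖ := Real.mul_self_sqrt (norm_nonneg _)
  have hD : ((stretchMap s hs ^ 2) θ).1 = !![‖z θ‖, 0; 0, ‖z θ‖⁻¹] := by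
    rw [sq]
    change !![√‖z θ‖, 0; 0, (√‖z θ‖)⁻¹] * !![√‖z θ‖, 0; 0, (√‖z θ‖)⁻¹] = _
    ext i j
    fin_cases i <;> fin_cases j <;>
      simp [Matrix.mul_apply, Fin.sum_univ_two, hss, ← mul_inv]
  have hu : (planeRotation (u θ)).1 = !![A θ 0 0 / ‖z θ‖, -(A θ 1 0 / ‖z θ‖);
      A θ 1 0 / ‖z θ‖, A θ 0 0 / ‖z θ‖] := by
    have hc : (u θ : ℂ) = z θ / ‖z θ‖ := rfl
    rw [planeRotation_coe, hc, Complex.div_ofReal_re, Complex.div_ofReal_im]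
  have hx : ((transvectionMap (zero_ne_one' (Fin 2)) x : C(Θ, SL(2, ℝ))) θ).1 =
      !![1, (A θ 0 0 * A θ 0 1 + A θ 1 0 * A θ 1 1) / (‖z θ‖ * ‖z θ‖); 0, 1] := by
    change (Matrix.SpecialLinearGroup.transvection (zero_ne_one' (Fin 2)) (x θ)).1 = _
    ext i j
    fin_cases i <;> fin_cases j <;> simp [Matrix.SpecialLinearGroup.transvection_coe, x]
  change _ = (planeRotation (u θ)).1 * ((stretchMap s hs ^ 2) θ).1 * (transvectionMap _ x θ).1
  rw [hu, hD, hx]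
  have h0 := (hn θ).ne'
  have h1 := hsq θ
  have h2 := hdet θ
  generalize ‖z θ‖ = r at *
  ext i j
  fin_cases i <;> fin_cases j <;> simp [Matrix.mul_apply, Fin.sum_univ_two]
  all_goals field_simp
  · linear_combination A θ 0 1 * h1 - A θ 1 0 * h2
  · linear_combination A θ 1 1 * h1 + A θ 0 0 * h2

/-- A loop in the circle that is run through twice is a square: its degree is even. -/
theorem exists_sq_eq_comp_two_nsmul (u : C(UnitAddCircle, Circle)) :
    ∃ w : C(UnitAddCircle, Circle), ∀ θ, w θ ^ 2 = u (2 • θ) := by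
  let p : C(ℝ, Circle) := ⟨fun x => u (x : UnitAddCircle), by fun_prop⟩
  obtain ⟨a, ha⟩ := Circle.exp_surjective (p 0)
  obtain ⟨f, ⟨-, hf⟩, -⟩ :=
    Circle.isCoveringMap_exp.existsUnique_continuousMap_lifts p 0 a ha
  have hf' (x : ℝ) : Circle.exp (f x) = u (x : UnitAddCircle) := congrFun hf x
  -- The increment of the lift `f` over a period is a constant multiple of `2π`.
  have hexp (x : ℝ) : Circle.exp (f (x + 1) - f x) = 1 := by
    rw [Circle.exp_sub, hf', hf', AddCircle.coe_add_period, div_self']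
  have hconst (x : ℝ) : f (x + 1) - f x = f (0 + 1) - f 0 :=
    Circle.isCoveringMap_exp.const_of_comp (g := fun x => f (x + 1) - f x) (by fun_prop)
      (fun x y => (hexp x).trans (hexp y).symm) x 0
  have hper : Function.Periodic (fun x : ℝ => Circle.exp (f (2 * x) / 2)) 1 := fun x => by
    have h : f (2 * (x + 1)) / 2 = f (2 * x) / 2 + (f (0 + 1) - f 0) := by
      have h1 := hconst (2 * x)
      have h2 := hconst (2 * x + 1)
      rw [show 2 * (x + 1) = 2 * x + 1 + 1 by ring]
      linear_combination (h1 + h2) / 2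
    simp only [h, Circle.exp_add, hexp, mul_one]
  refine ⟨⟨hper.lift, ?_⟩, fun θ => ?_⟩
  · exact continuous_quot_lift _ (by fun_prop)
  · induction θ using QuotientAddGroup.induction_on with
    | H x =>
      change Circle.exp (f (2 * x) / 2) ^ 2 = u (2 • (x : UnitAddCircle))
      rw [sq, ← Circle.exp_add, add_halves, hf', two_mul, two_nsmul, AddCircle.coe_add]

/-- The multiplication by two of the circle. -/
def doubling : C(UnitAddCircle, UnitAddCircle) := ⟨fun θ => 2 • θ, by fun_prop⟩

theorem cornerMap_comp_doubling_mem (A : C(UnitAddCircle, SL(2, ℝ))) :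
    cornerMap _ (A.comp doubling) ∈ nullhomotopicMaps UnitAddCircle 3 := by
  obtain ⟨u, s, hs, x, hA⟩ := exists_iwasawa A
  obtain ⟨w, hw⟩ := exists_sq_eq_comp_two_nsmul u
  have hu : u.comp doubling = w ^ 2 := ContinuousMap.ext fun θ => (hw θ).symm
  have h : A.comp doubling = rotationMap _ (u.comp doubling) *
      stretchMap (s.comp doubling) (fun _ => hs _) ^ 2 *
        transvectionMap (zero_ne_one' (Fin 2)) (x.comp doubling) := by
    rw [sq] at hA ⊢
    conv_lhs => rw [hA]
    rfl
  rw [h, map_mul, map_mul, cornerMap_transvectionMap, hu, map_pow]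
  refine mul_mem (mul_mem (cornerMap_sq_mem fun θ => ?_) (cornerMap_sq_mem fun θ => ?_))
    (transvectionMap_mem_nullhomotopicMaps _ _)
  · rfl
  · exact neg_zero.symm

/-! ### Embedding a cocycle over the rotation by `α` -/

theorem two_nsmul_circleRotation_zpow (α : ℝ) (n : ℤ) (θ : UnitAddCircle) :
    2 • (circleRotation (α / 2) ^ n) θ = (circleRotation α ^ n) (2 • θ) := by
  have step (β : ℝ) (m : ℤ) (η : UnitAddCircle) :
      (circleRotation β ^ (m + 1)) η = (circleRotation β ^ m) η + (β : UnitAddCircle) := by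
    rw [add_comm, zpow_one_add]
    rfl
  have hα : 2 • ((α / 2 : ℝ) : UnitAddCircle) = (α : UnitAddCircle) := by
    rw [two_nsmul, ← AddCircle.coe_add, add_halves]
  induction n using Int.induction_on with
  | zero => rfl
  | succ n ih => rw [step, step, nsmul_add, ih, hα]
  | pred n ih =>
    have h := step (α / 2) (-(n : ℤ) - 1) θ
    have h' := step α (-(n : ℤ) - 1) (2 • θ)
    rw [sub_add_cancel] at h h'
    rw [h, h', nsmul_add, hα] at ih
    exact add_right_cancel ih

theorem stepMap_cornerMap_comp_doubling (α : ℝ) (A : C(UnitAddCircle, SL(2, ℝ))) (n : ℤ)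
    (θ : UnitAddCircle) :
    stepMap (circleRotation (α / 2)) (cornerMap _ (A.comp doubling)) n θ =
      corner (stepMap (circleRotation α) A n (2 • θ)) := by
  have hB (η : UnitAddCircle) : cornerMap _ (A.comp doubling) η = corner (A (2 • η)) := rfl
  induction n using Int.induction_on with
  | zero => rw [stepMap_zero, stepMap_zero, map_one]
  | succ n ih => rw [stepMap_add_one, stepMap_add_one, ih, hB, two_nsmul_circleRotation_zpow,
      map_mul]
  | pred n ih =>
    have h := stepMap_add_one (circleRotation (α / 2)) (cornerMap _ (A.comp doubling))
      (-(n : ℤ) - 1) θ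
    have h' := stepMap_add_one (circleRotation α) A (-(n : ℤ) - 1) (2 • θ)
    rw [sub_add_cancel] at h h'
    rw [ih, h', map_mul, hB, two_nsmul_circleRotation_zpow] at h
    exact (mul_left_cancel h).symm

end

theorem corollary3p5 (α : ℝ) (A : C(UnitAddCircle, SL(2, ℝ))) :
    ∃ Φ : ℝ → MappingTorus (circleRotation (α / 2)) → SL(3, ℝ),
      IsContinuousTimeCocycle (circleRotation (α / 2)) Φ ∧
      ∀ (n : ℤ) (θ : UnitAddCircle) (v : Fin 2 → ℝ) (w : ℝ),
        (Φ (n : ℝ) (MappingTorus.mk (circleRotation (α / 2)) θ 0)).1.mulVec (joinVec v w) =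
          joinVec ((stepMap (circleRotation α) A n (2 • θ)).1.mulVec v) w := by
  obtain ⟨H⟩ := cornerMap_comp_doubling_mem A
  refine ⟨H.cocycle _, H.isContinuousTimeCocycle _, fun n θ v w => ?_⟩
  rw [H.cocycle_intCast, stepMap_cornerMap_comp_doubling, corner_mulVec]
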